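/- Let $p\in(0,1)$. For $n\ge 0$ and a placement $x=(x_1,\dots,x_n)$ of $n$ sensors on the line, let $$C_0(x_A)=\max_{s\in[0,1]}\min_{j\in A}|s-x_j|\quad(\emptyset\ne A\subseteq\{1,\dots,n\}),\qquad C_0(x_\emptyset)=1,$$ be the coverage cost when $A$ is the set of active sensors, and let $$C(x)=\sum_{A\subseteq\{1,\dots,n\}}p^{\,n-|A|}(1-p)^{|A|}\,C_0(x_A)$$ be its average over the failures, where each sensor fails with probability $p$, independently of the other sensors and of the positions. For each $n$ let the entries of $x^{\mathrm{rand}}=(x^{\mathrm{rand}}_1,\dots,x^{\mathrm{rand}}_n)$ be i.i.d. random variables, uniformly distributed on $[0,1]$, and let $\mathbb E$ denote expectation with respect to these positions. Then $C(x^{\mathrm{rand}})$ is integrable for every $n$ and, as $n\to\infty$, $$\mathbb E[C(x^{\mathrm{rand}})]=\frac{1}{2(1-p)}\,\frac{\log n}{n}+O\!\left(\frac1n\right).$$ The constant $\frac1{2(1-p)}$ is strictly larger than the corresponding constant for the equispaced placement $x^{\mathrm{eq}}=\frac1{2n}(1,3,\dots,2n-1)$: as $n\to\infty$, $$C(x^{\mathrm{eq}})=\frac{1}{2\log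 p^{-1}}\,\frac{\log n}{n}+O\!\left(\frac1n\right),\qquad\text{and}\qquad \frac{1}{2\log p^{-1}}<\frac1{2(1-p)}.$$ -/

import Mathlib

open MeasureTheory ProbabilityTheory Filter Asymptotics

noncomputable section

/-- Coverage cost `max_{s ∈ [0,1]} min_{j ∈ A} |s - x_j|` of the placement `x` when `A` is the set
of active sensors; it is `1` by convention when no sensor is active. -/
def coverageCost {n : ℕ} (x : Fin n → ℝ) (A : Finset (Fin n)) : ℝ :=
  if hA : A.Nonempty then
    ⨆ s : Set.Icc (0 : ℝ) 1, A.inf' hA (fun j => |(s : ℝ) - x j|)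
  else 1

/-- Probability that `A` is exactly the set of active sensors among `n` sensors, each of which
fails with probability `p`, independently of the others. -/
def activeProb (p : ℝ) {n : ℕ} (A : Finset (Fin n)) : ℝ :=
  p ^ (n - A.card) * (1 - p) ^ A.card

/-- Cost of the placement `x`: the coverage cost averaged over the failures of the sensors. -/
def averageCost (p : ℝ) {n : ℕ} (x : Fin n → ℝ) : ℝ :=
  ∑ A : Finset (Fin n), activeProb p A * coverageCost x A

/-- The equispaced placement `(1, 3, …, 2n - 1) / (2n)`. -/
def equispaced (n : ℕ) (i : Fin n) : ℝ :=
  (2 * (i : ℕ) + 1) / (2 * n)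

end

/-! Apart from the two ends of `[0,1]`, the coverage cost is half the longest interval free of
active sensors. Measure it in units of `1/(2n)` and cut `[0,1]` into `n` cells. If `s` given cells
are vacant with probability about `exp (-(b * s))`, the expected number of vacant runs of `j` cells
is of order `n * exp (-(b * j))`, so the longest run has about `log n / b` cells and the mean cost
is `log n / (2 * b * n)` up to `O(1/n)`. For uniform positions the vacancy probability is `(1 -
(1-p)s/n)^n`, whence `b = 1 - p`. The equispaced placement has one sensor per cell, so it is `p^s`
and `b = log p⁻¹`. The constants are ordered by `log p < p - 1`.

Both bounds are proved under the product of the law of the positions (a Dirac mass for the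
equispaced placement) and the law of the active set. From above, a union bound over runs
(`measureReal_lt_coverageCost_le`) is summed over levels by `integral_le_of_tail`. From below, a
second moment argument (`one_sub_le_measureReal_exists_run`) shows that runs shorter than `log n /
b` exist with probability close to one, and `le_integral_of_tail` sums this. It counts left ends of
runs, so that overlapping runs do not inflate the variance.

For uniform positions vacancies of distinct cells are dependent. On a grid of `n²` cells the
differences of vacancy probabilities are nearly derivatives of a power, and the dependence costs
only a factor `1 + O(log n / n)` (`binomial_run_bounds`). -/

noncomputable section

/-! ### Layer-cake estimates -/

section LayerCake

variable {Ω : Type*} [MeasurableSpace Ω] {μ : Measure Ω} [IsProbabilityMeasure μ]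

lemma sum_exp_neg_le {b : ℝ} (hb : 0 < b) (m : ℕ) :
    ∑ i ∈ Finset.range m, Real.exp (-(b * i)) ≤ (1 - Real.exp (-b))⁻¹ := by
  have h1 : Real.exp (-b) < 1 := by simpa using hb
  have h : ∀ i : ℕ, Real.exp (-(b * i)) = Real.exp (-b) ^ i := fun i => by
    rw [← Real.exp_nat_mul]; congr 1; ring
  simp only [h]
  rw [← tsum_geometric_of_lt_one (Real.exp_pos _).le h1]
  exact (summable_geometric_of_lt_one (Real.exp_pos _).le h1).sum_le_tsum _
    fun i _ => pow_nonneg (Real.exp_pos _).le _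

lemma sum_exp_succ_le {b : ℝ} (hb : 0 < b) (m : ℕ) :
    ∑ i ∈ Finset.range m, Real.exp (b * (i + 1)) ≤
      Real.exp (b * m) * (1 - Real.exp (-b))⁻¹ := by
  have h1 : 0 < 1 - Real.exp (-b) := by simpa using hb
  induction m with
  | zero => simpa using h1.le
  | succ m ih =>
    rw [Finset.sum_range_succ]
    have : Real.exp (b * m) = Real.exp (b * (m + 1)) * Real.exp (-b) := by
      rw [← Real.exp_add]; congr 1; ring
    rw [this] at ih
    push_cast
    calc _ ≤ Real.exp (b * (m + 1)) * Real.exp (-b) * (1 - Real.exp (-b))⁻¹ +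
          Real.exp (b * (m + 1)) := by gcongr
      _ = _ := by field_simp; ring

/-- Pointwise form of the layer-cake upper bound: for `y ≥ 0` the sum counts the naturals below `y`,
which is `⌈y⌉`. -/
lemma le_sum_ite_lt {m : ℕ} {y : ℝ} (hy : y ≤ m) :
    y ≤ ∑ j ∈ Finset.range m, if (j : ℝ) < y then (1 : ℝ) else 0 := by
  induction m with
  | zero => simpa using hy
  | succ m ih =>
    rw [Finset.sum_range_succ]
    push_cast at hy
    rcases le_or_gt y m with h | h
    · rw [if_neg h.not_gt, add_zero]; exact ih h
    · have : ∑ j ∈ Finset.range m, (if (j : ℝ) < y then (1 : ℝ) else 0) = m := by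
        rw [Finset.sum_congr rfl (g := fun _ => (1 : ℝ))]
        · simp
        · intro j hj
          rw [if_pos]
          have : (j : ℝ) < m := by exact_mod_cast Finset.mem_range.1 hj
          linarith
      rw [this, if_pos h]; exact hy

lemma sum_ite_le_le (m : ℕ) {y : ℝ} (hy : 0 ≤ y) :
    ∑ j ∈ Finset.range m, (if (j : ℝ) + 1 ≤ y then (1 : ℝ) else 0) ≤ y := by
  have h : ∀ k : ℕ, ∑ j ∈ Finset.range k, (if (j : ℝ) + 1 ≤ y then (1 : ℝ) else 0) ≤ k := by
    intro k
    calc _ ≤ ∑ j ∈ Finset.range k, (1 : ℝ) :=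
          Finset.sum_le_sum fun j _ => by split_ifs <;> norm_num
      _ = k := by simp
  induction m with
  | zero => simpa using hy
  | succ m ih =>
    by_cases hm : (m : ℝ) + 1 ≤ y
    · have := h (m + 1)
      push_cast at this
      exact this.trans hm
    · rw [Finset.sum_range_succ, if_neg hm, add_zero]; exact ih

lemma integral_le_sum_measureReal_lt {Y : Ω → ℝ} (hY : Measurable Y) (hi : Integrable Y μ) {m : ℕ}
    (hm : ∀ᵐ ω ∂μ, Y ω ≤ m) :
    ∫ ω, Y ω ∂μ ≤ ∑ j ∈ Finset.range m, μ.real {ω | (j : ℝ) < Y ω} := by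
  have hs : ∀ j : ℕ, MeasurableSet {ω | (j : ℝ) < Y ω} := fun j =>
    measurableSet_lt measurable_const hY
  have hI : ∀ j : ℕ, Integrable ({ω | (j : ℝ) < Y ω}.indicator (1 : Ω → ℝ)) μ := fun j =>
    (integrable_const (1 : ℝ)).indicator (hs j)
  simp_rw [← fun j => integral_indicator_one (μ := μ) (hs j)]
  rw [← integral_finsetSum _ fun j _ => hI j]
  refine integral_mono_ae hi (integrable_finsetSum _ fun j _ => hI j) ?_
  filter_upwards [hm] with ω hω
  simpa [Set.indicator_apply] using le_sum_ite_lt hω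

lemma sum_measureReal_le_integral {Y : Ω → ℝ} (hY : Measurable Y) (hi : Integrable Y μ)
    (h0 : ∀ ω, 0 ≤ Y ω) (m : ℕ) :
    ∑ j ∈ Finset.range m, μ.real {ω | (j : ℝ) + 1 ≤ Y ω} ≤ ∫ ω, Y ω ∂μ := by
  have hs : ∀ j : ℕ, MeasurableSet {ω | (j : ℝ) + 1 ≤ Y ω} := fun j =>
    measurableSet_le measurable_const hY
  have hI : ∀ j : ℕ, Integrable ({ω | (j : ℝ) + 1 ≤ Y ω}.indicator (1 : Ω → ℝ)) μ := fun j =>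
    (integrable_const (1 : ℝ)).indicator (hs j)
  simp_rw [← fun j => integral_indicator_one (μ := μ) (hs j)]
  rw [← integral_finsetSum _ fun j _ => hI j]
  refine integral_mono (integrable_finsetSum _ fun j _ => hI j) hi ?_
  intro ω
  simpa [Set.indicator_apply] using sum_ite_le_le m (h0 ω)

/-- Exponential tails beyond `log n / b` bound the mean by `log n / b + O(1)`. -/
lemma integral_le_of_tail {Y : Ω → ℝ} (hY : Measurable Y) (hi : Integrable Y μ) {n m : ℕ}
    (hn : 1 ≤ n) (hm : ∀ᵐ ω ∂μ, Y ω ≤ m) {b C : ℝ} (hb : 0 < b) (hC : 0 ≤ C)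
    (htail : ∀ j : ℕ, μ.real {ω | (j : ℝ) < Y ω} ≤
      C * (n * Real.exp (-(b * j)) + Real.exp (-(b / 2 * j)))) :
    ∫ ω, Y ω ∂μ ≤ Real.log n / b +
      C * (Real.exp b * (1 - Real.exp (-b))⁻¹ + (1 - Real.exp (-(b / 2)))⁻¹) := by
  have hn0 : (0 : ℝ) < n := by exact_mod_cast hn
  have hlog : 0 ≤ Real.log n := Real.log_natCast_nonneg n
  set J := ⌊Real.log n / b⌋₊ with hJ
  have hJle : (J : ℝ) ≤ Real.log n / b := Nat.floor_le (by positivity)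
  have hJlt : Real.log n / b < J + 1 := Nat.lt_floor_add_one _
  have hexp : n * Real.exp (-(b * J)) ≤ Real.exp b := by
    rw [div_lt_iff₀ hb] at hJlt
    calc n * Real.exp (-(b * J)) = Real.exp (Real.log n - b * J) := by
          rw [sub_eq_add_neg, Real.exp_add, Real.exp_log hn0]
      _ ≤ _ := Real.exp_le_exp.2 (by nlinarith)
  -- Extending the range beyond `m` is harmless and lets the sum split at `J`: levels below `J` cost
  -- at most 1 each, and past `J` the factor `n` is absorbed by `hexp`, leaving geometric series.
  calc ∫ ω, Y ω ∂μ ≤ ∑ j ∈ Finset.range (J + m), μ.real {ω | (j : ℝ) < Y ω} := by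
        refine integral_le_sum_measureReal_lt hY hi ?_
        filter_upwards [hm] with ω hω
        push_cast
        have : (0 : ℝ) ≤ J := J.cast_nonneg
        linarith
    _ = ∑ j ∈ Finset.range J, μ.real {ω | (j : ℝ) < Y ω} +
        ∑ i ∈ Finset.range m, μ.real {ω | ((J + i : ℕ) : ℝ) < Y ω} := Finset.sum_range_add _ _ _
    _ ≤ ∑ j ∈ Finset.range J, (1 : ℝ) + ∑ i ∈ Finset.range m,
        C * (Real.exp b * Real.exp (-(b * i)) + Real.exp (-(b / 2 * i))) := by
        gcongr with j _ i _
        · exact measureReal_le_one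
        · refine (htail _).trans (mul_le_mul_of_nonneg_left (add_le_add ?_ ?_) hC)
          · push_cast
            rw [mul_add, neg_add, Real.exp_add, ← mul_assoc]
            exact mul_le_mul_of_nonneg_right hexp (Real.exp_pos _).le
          · refine Real.exp_le_exp.2 (neg_le_neg ?_)
            gcongr
            exact Nat.le_add_left i J
    _ = J + C * (Real.exp b * ∑ i ∈ Finset.range m, Real.exp (-(b * i)) +
          ∑ i ∈ Finset.range m, Real.exp (-(b / 2 * i))) := by
        rw [Finset.mul_sum, ← Finset.sum_add_distrib, Finset.mul_sum]
        simp
    _ ≤ _ := by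
        gcongr
        · exact sum_exp_neg_le hb m
        · exact sum_exp_neg_le (half_pos hb) m

/-- A mean is at least `log n / b - O(1)` when the levels below `log n / b` are exceeded with
probability close to one. -/
lemma le_integral_of_tail {Y : Ω → ℝ} (hY : Measurable Y) (hi : Integrable Y μ)
    (h0 : ∀ ω, 0 ≤ Y ω) {n : ℕ} (hn : 1 ≤ n) {b D ε : ℝ} (hb : 0 < b) (hD : 0 ≤ D) (hε : 0 ≤ ε)
    (hεn : ε * Real.log n ≤ 1)
    (htail : ∀ j : ℕ, b * j ≤ Real.log n →
      1 - D * Real.exp (b * j) / n - ε ≤ μ.real {ω | (j : ℝ) ≤ Y ω}) :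
    Real.log n / b - (1 + D * (1 - Real.exp (-b))⁻¹ + 1 / b) ≤ ∫ ω, Y ω ∂μ := by
  have hn0 : (0 : ℝ) < n := by exact_mod_cast hn
  have hlog : 0 ≤ Real.log n := Real.log_natCast_nonneg n
  have h1 : 0 < 1 - Real.exp (-b) := by simpa using hb
  set J := ⌊Real.log n / b⌋₊ with hJ
  have hJle : (J : ℝ) ≤ Real.log n / b := Nat.floor_le (by positivity)
  have hJlt : Real.log n / b < J + 1 := Nat.lt_floor_add_one _
  have hbJ : b * J ≤ Real.log n := by rw [le_div_iff₀ hb] at hJle; linarith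
  have hexp : Real.exp (b * J) ≤ n := by
    rw [← Real.exp_log hn0]; exact Real.exp_le_exp.2 hbJ
  -- The loss `ε` is paid at each of about `log n / b` levels; `hεn` keeps the total bounded.
  have hεJ : J * ε ≤ 1 / b := by
    calc J * ε ≤ Real.log n / b * ε := by gcongr
      _ = (ε * Real.log n) / b := by ring
      _ ≤ 1 / b := by gcongr
  have hDJ : D / n * ∑ i ∈ Finset.range J, Real.exp (b * (i + 1)) ≤ D * (1 - Real.exp (-b))⁻¹ := by
    calc _ ≤ D / n * (n * (1 - Real.exp (-b))⁻¹) := by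
          gcongr
          refine (sum_exp_succ_le hb J).trans ?_
          gcongr
      _ = _ := by field_simp
  calc _ ≤ J - D / n * ∑ i ∈ Finset.range J, Real.exp (b * (i + 1)) - J * ε := by linarith
    _ = ∑ i ∈ Finset.range J, (1 - D * Real.exp (b * ((i + 1 : ℕ) : ℝ)) / n - ε) := by
        simp only [Finset.sum_sub_distrib, Finset.mul_sum]
        simp only [Finset.sum_const, Finset.card_range, nsmul_eq_mul, mul_one]
        congr 2
        refine Finset.sum_congr rfl fun i _ => ?_
        push_cast; ring
    _ ≤ ∑ i ∈ Finset.range J, μ.real {ω | (i : ℝ) + 1 ≤ Y ω} := by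
        refine Finset.sum_le_sum fun i hi => ?_
        refine (htail (i + 1) ?_).trans (by push_cast; exact le_rfl)
        refine le_trans ?_ hbJ
        gcongr
        exact Finset.mem_range.1 hi
    _ ≤ _ := sum_measureReal_le_integral hY hi h0 J

end LayerCake

/-! ### Second moment bound for vacant runs -/

section SecondMoment

variable {Ω : Type*} [MeasurableSpace Ω] {μ : Measure Ω} [IsProbabilityMeasure μ]

/-- Indicator that all the events `V k`, `k ∈ S`, occur. -/
def jointInd (V : ℕ → Set Ω) (S : Finset ℕ) : Ω → ℝ := (⋂ k ∈ S, V k).indicator 1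

omit [MeasurableSpace Ω] in
lemma jointInd_mul (V : ℕ → Set Ω) (S T : Finset ℕ) (ω : Ω) :
    jointInd V S ω * jointInd V T ω = jointInd V (S ∪ T) ω := by
  have h : ⋂ k ∈ S ∪ T, V k = (⋂ k ∈ S, V k) ∩ ⋂ k ∈ T, V k := by
    ext; simp [or_imp, forall_and]
  rw [jointInd, jointInd, jointInd, h, Set.inter_indicator_one, Pi.mul_apply]

lemma integrable_jointInd {V : ℕ → Set Ω} (hV : ∀ k, MeasurableSet (V k)) (S : Finset ℕ) :
    Integrable (jointInd V S) μ :=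
  (integrable_const (1 : ℝ)).indicator (S.measurableSet_biInter fun k _ => hV k)

omit [IsProbabilityMeasure μ] in
lemma integral_jointInd {V : ℕ → Set Ω} (hV : ∀ k, MeasurableSet (V k)) (S : Finset ℕ) :
    ∫ ω, jointInd V S ω ∂μ = μ.real (⋂ k ∈ S, V k) :=
  integral_indicator_one (S.measurableSet_biInter fun k _ => hV k)

/-- Indicator that `V k` fails and is followed by the `L` events `V (k+1), …, V (k+L)`. -/
def runStart (V : ℕ → Set Ω) (L k : ℕ) (ω : Ω) : ℝ :=
  jointInd V (Finset.Ico (k + 1) (k + 1 + L)) ω - jointInd V (Finset.Ico k (k + 1 + L)) ω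

-- A start at `l` needs `V l` to fail, while a start at `k` puts `V l` inside its run. Hence close
-- pairs contribute nothing to the second moment.
omit [MeasurableSpace Ω] in
lemma runStart_mul_eq_zero (V : ℕ → Set Ω) {L k l : ℕ} (hkl : k < l) (hl : l ≤ k + L) (ω : Ω) :
    runStart V L k ω * runStart V L l ω = 0 := by
  have e1 : Finset.Ico (k + 1) (k + 1 + L) ∪ Finset.Ico (l + 1) (l + 1 + L) =
      Finset.Ico (k + 1) (k + 1 + L) ∪ Finset.Ico l (l + 1 + L) := by
    ext i; simp only [Finset.mem_union, Finset.mem_Ico]; omega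
  have e2 : Finset.Ico k (k + 1 + L) ∪ Finset.Ico (l + 1) (l + 1 + L) =
      Finset.Ico k (k + 1 + L) ∪ Finset.Ico l (l + 1 + L) := by
    ext i; simp only [Finset.mem_union, Finset.mem_Ico]; omega
  simp only [runStart, sub_mul, mul_sub, jointInd_mul, e1, e2]
  ring

omit [MeasurableSpace Ω] in
lemma runStart_mul_self (V : ℕ → Set Ω) (L k : ℕ) (ω : Ω) :
    runStart V L k ω * runStart V L k ω = runStart V L k ω := by
  have e1 : Finset.Ico (k + 1) (k + 1 + L) ∪ Finset.Ico k (k + 1 + L) =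
      Finset.Ico k (k + 1 + L) := by
    ext i; simp only [Finset.mem_union, Finset.mem_Ico]; omega
  have e2 : Finset.Ico k (k + 1 + L) ∪ Finset.Ico (k + 1) (k + 1 + L) =
      Finset.Ico k (k + 1 + L) := by
    ext i; simp only [Finset.mem_union, Finset.mem_Ico]; omega
  simp only [runStart, sub_mul, mul_sub, jointInd_mul, e1, e2, Finset.union_self]
  ring

lemma integrable_runStart {V : ℕ → Set Ω} (hV : ∀ k, MeasurableSet (V k)) (L k : ℕ) :
    Integrable (runStart V L k) μ :=
  (integrable_jointInd hV _).sub (integrable_jointInd hV _)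

lemma integrable_runStart_mul {V : ℕ → Set Ω} (hV : ∀ k, MeasurableSet (V k)) (L k l : ℕ) :
    Integrable (fun ω => runStart V L k ω * runStart V L l ω) μ := by
  simp only [runStart, sub_mul, mul_sub, jointInd_mul]
  exact ((integrable_jointInd hV _).sub (integrable_jointInd hV _)).sub
    ((integrable_jointInd hV _).sub (integrable_jointInd hV _))

lemma integral_runStart {V : ℕ → Set Ω} (hV : ∀ k, MeasurableSet (V k)) {φ : ℕ → ℝ} {M : ℕ}
    (hφ : ∀ S ⊆ Finset.range M, μ.real (⋂ k ∈ S, V k) = φ S.card) {L k : ℕ} (hk : k + L < M) :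
    ∫ ω, runStart V L k ω ∂μ = φ L - φ (L + 1) := by
  simp only [runStart]
  rw [integral_sub (integrable_jointInd hV _) (integrable_jointInd hV _), integral_jointInd hV,
    integral_jointInd hV, hφ, hφ, Nat.card_Ico, Nat.card_Ico]
  · congr 2 <;> omega
  all_goals
    intro i; simp only [Finset.mem_Ico, Finset.mem_range]; omega

lemma integral_runStart_mul {V : ℕ → Set Ω} (hV : ∀ k, MeasurableSet (V k)) {φ : ℕ → ℝ} {M : ℕ}
    (hφ : ∀ S ⊆ Finset.range M, μ.real (⋂ k ∈ S, V k) = φ S.card) {L k l : ℕ} (hkl : k + L < l)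
    (hl : l + L < M) :
    ∫ ω, runStart V L k ω * runStart V L l ω ∂μ =
      φ (2 * L) - 2 * φ (2 * L + 1) + φ (2 * L + 2) := by
  -- `c` and `d` record whether the indices `k` and `l` are dropped (value 1). The two blocks are
  -- disjoint because `k + L < l`, so only their total size matters.
  have key : ∀ c d : ℕ, c ≤ 1 → d ≤ 1 →
      ∫ ω, jointInd V (Finset.Ico (k + c) (k + 1 + L) ∪ Finset.Ico (l + d) (l + 1 + L)) ω ∂μ =
        φ (2 * L + (1 - c) + (1 - d)) := by
    intro c d hc hd
    rw [integral_jointInd hV, hφ, Finset.card_union_of_disjoint, Nat.card_Ico, Nat.card_Ico]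
    · congr 1; omega
    · rw [Finset.disjoint_left]; intro i; simp only [Finset.mem_Ico]; omega
    · intro i; simp only [Finset.mem_union, Finset.mem_Ico, Finset.mem_range]; omega
  simp only [runStart, sub_mul, mul_sub, jointInd_mul]
  rw [integral_sub (by exact (integrable_jointInd hV _).sub (integrable_jointInd hV _))
      (by exact (integrable_jointInd hV _).sub (integrable_jointInd hV _)),
    integral_sub (integrable_jointInd hV _) (integrable_jointInd hV _),
    integral_sub (integrable_jointInd hV _) (integrable_jointInd hV _)]
  have h1 := key 1 1 le_rfl le_rfl
  have h2 := key 1 0 le_rfl zero_le_one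
  have h3 := key 0 1 zero_le_one le_rfl
  have h4 := key 0 0 zero_le_one zero_le_one
  simp only [add_zero, Nat.sub_self, Nat.sub_zero] at h1 h2 h3 h4
  rw [h1, h2, h3, h4]
  ring

/-- Second moment bound: a run of `L` consecutive events among `M` exchangeable events
occurs with probability close to one when the expected number of runs is large. -/
lemma one_sub_le_measureReal_exists_run {V : ℕ → Set Ω} (hV : ∀ k, MeasurableSet (V k))
    {φ : ℕ → ℝ} {M : ℕ}
    (hφ : ∀ S ⊆ Finset.range M, μ.real (⋂ k ∈ S, V k) = φ S.card) {L : ℕ} (hL : L < M)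
    {ε : ℝ} (hε : 0 ≤ ε) (hq : 0 < φ L - φ (L + 1))
    (hq2 : φ (2 * L) - 2 * φ (2 * L + 1) + φ (2 * L + 2) ≤ (1 + ε) * (φ L - φ (L + 1)) ^ 2) :
    1 - 1 / (((M : ℝ) - L) * (φ L - φ (L + 1))) - ε ≤
      μ.real (⋃ k ∈ Finset.range (M - L), ⋂ i ∈ Finset.Ico (k + 1) (k + 1 + L), V i) := by
  set q := φ L - φ (L + 1) with hqdef
  set m := M - L with hm
  have hmM : ((m : ℕ) : ℝ) = (M : ℝ) - L := by rw [hm, Nat.cast_sub hL.le]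
  have hm0 : (0 : ℝ) < m := by rw [hmM, sub_pos]; exact_mod_cast hL
  rw [← hmM]
  set E : Set Ω := ⋃ k ∈ Finset.range m, ⋂ i ∈ Finset.Ico (k + 1) (k + 1 + L), V i with hE
  have hEm : MeasurableSet E := Finset.measurableSet_biUnion _ fun k _ =>
    Finset.measurableSet_biInter _ fun i _ => hV i
  set N : Ω → ℝ := fun ω => ∑ k ∈ Finset.range m, runStart V L k ω with hN
  have hNi : Integrable N μ := integrable_finsetSum _ fun k _ => integrable_runStart hV L k
  have hN2 : (fun ω => N ω ^ 2) = fun ω => ∑ k ∈ Finset.range m, ∑ l ∈ Finset.range m,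
      runStart V L k ω * runStart V L l ω := by
    funext ω; rw [hN]; simp only [pow_two, Finset.sum_mul_sum]
  have hN2i : Integrable (fun ω => N ω ^ 2) μ := by
    rw [hN2]
    exact integrable_finsetSum _ fun k _ => integrable_finsetSum _ fun l _ =>
      integrable_runStart_mul hV L k l
  have hEN : ∫ ω, N ω ∂μ = m * q := by
    rw [integral_finsetSum _ fun k _ => integrable_runStart hV L k,
      Finset.sum_congr rfl (g := fun _ => q)]
    · simp
    · intro k hk
      exact integral_runStart hV hφ (by have := Finset.mem_range.1 hk; omega)
  have hpair : ∀ k ∈ Finset.range m, ∀ l ∈ Finset.range m,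
      ∫ ω, runStart V L k ω * runStart V L l ω ∂μ ≤
        (if k = l then q else 0) + (1 + ε) * q ^ 2 := by
    have hlt : ∀ k l : ℕ, k < l → l < m →
        ∫ ω, runStart V L k ω * runStart V L l ω ∂μ ≤ (1 + ε) * q ^ 2 := by
      intro k l hkl hl
      rcases le_or_gt l (k + L) with h | h
      · simp only [runStart_mul_eq_zero V hkl h, integral_zero]
        positivity
      · rw [integral_runStart_mul hV hφ h (by omega)]
        exact hq2
    intro k hk l hl
    rw [Finset.mem_range] at hk hl
    rcases lt_trichotomy k l with h | h | h
    · rw [if_neg h.ne, zero_add]; exact hlt k l h hl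
    · subst h
      simp only [runStart_mul_self, if_true]
      rw [integral_runStart hV hφ (by omega)]
      have : 0 ≤ (1 + ε) * q ^ 2 := by positivity
      linarith
    · rw [if_neg h.ne', zero_add]
      simp only [mul_comm (runStart V L k _)]
      exact hlt l k h hk
  have hEN2 : ∫ ω, N ω ^ 2 ∂μ ≤ m * q + m ^ 2 * ((1 + ε) * q ^ 2) := by
    rw [hN2, integral_finsetSum _ fun k _ => integrable_finsetSum _ fun l _ =>
      integrable_runStart_mul hV L k l]
    calc _ ≤ ∑ k ∈ Finset.range m, (q + m * ((1 + ε) * q ^ 2)) := by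
          refine Finset.sum_le_sum fun k hk => ?_
          rw [integral_finsetSum _ fun l _ => integrable_runStart_mul hV L k l]
          refine (Finset.sum_le_sum fun l hl => hpair k hk l hl).trans ?_
          rw [Finset.sum_add_distrib, Finset.sum_ite_eq, if_pos hk]
          simp
      _ = _ := by simp; ring
  -- `c` is the inverse mean of `N`. On `E`, `2cN - c²N² ≤ 1` is `(1 - cN)² ≥ 0`; off `E` no run
  -- starts, so `N = 0`. Integrating gives the second moment bound without dividing random
  -- quantities.
  set c : ℝ := 1 / (m * q) with hc
  have hpt : ∀ ω, 2 * c * N ω - c ^ 2 * N ω ^ 2 ≤ E.indicator (1 : Ω → ℝ) ω := by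
    intro ω
    by_cases hω : ω ∈ E
    · rw [Set.indicator_of_mem hω, Pi.one_apply]
      nlinarith [sq_nonneg (1 - c * N ω)]
    · have hz : N ω = 0 := by
        refine Finset.sum_eq_zero fun k hk => ?_
        have h1 : ω ∉ ⋂ i ∈ Finset.Ico (k + 1) (k + 1 + L), V i := fun h => hω (by
          rw [hE]; exact Set.mem_biUnion (Finset.mem_coe.2 hk) h)
        have h2 : ω ∉ ⋂ i ∈ Finset.Ico k (k + 1 + L), V i := fun h => h1 (by
          simp only [Set.mem_iInter, Finset.mem_Ico] at h ⊢
          exact fun i hi => h i ⟨by omega, hi.2⟩)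
        simp only [runStart, jointInd, Set.indicator_of_notMem h1, Set.indicator_of_notMem h2,
          sub_self]
      rw [Set.indicator_of_notMem hω, hz]; simp
  have hint := integral_mono (μ := μ) ((hNi.const_mul (2 * c)).sub (hN2i.const_mul (c ^ 2)))
    (g := E.indicator 1) ((integrable_const (1 : ℝ)).indicator hEm) hpt
  rw [integral_indicator_one hEm] at hint
  refine le_trans ?_ hint
  simp only [Pi.sub_apply]
  rw [integral_sub (hNi.const_mul _) (hN2i.const_mul _), integral_const_mul, integral_const_mul,
    hEN]
  calc 1 - 1 / (m * q) - ε = 2 * c * (m * q) - c ^ 2 * (m * q + m ^ 2 * ((1 + ε) * q ^ 2)) := by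
        rw [hc]; field_simp; ring
    _ ≤ _ := by gcongr

end SecondMoment

/-! ### Coverage cost and gaps -/

section Geometry

variable {n : ℕ}

lemma bddAbove_range_inf' (x : Fin n → ℝ) {A : Finset (Fin n)} (hA : A.Nonempty) :
    BddAbove (Set.range fun s : Set.Icc (0 : ℝ) 1 => A.inf' hA fun j => |(s : ℝ) - x j|) := by
  obtain ⟨j, hj⟩ := hA
  refine ⟨1 + |x j|, ?_⟩
  rintro _ ⟨s, rfl⟩
  refine (Finset.inf'_le _ hj).trans ((abs_sub _ _).trans ?_)
  rw [abs_of_nonneg s.2.1]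
  linarith [s.2.2]

lemma coverageCost_nonneg (x : Fin n → ℝ) (A : Finset (Fin n)) : 0 ≤ coverageCost x A := by
  rw [coverageCost]
  split_ifs with hA
  · refine le_ciSup_of_le (bddAbove_range_inf' x hA) ⟨0, by simp⟩ ?_
    exact Finset.le_inf' _ _ fun j _ => abs_nonneg _
  · exact zero_le_one

lemma coverageCost_le_one {x : Fin n → ℝ} (hx : ∀ i, x i ∈ Set.Icc (0 : ℝ) 1)
    (A : Finset (Fin n)) : coverageCost x A ≤ 1 := by
  rw [coverageCost]
  split_ifs with hA
  · have : Nonempty (Set.Icc (0 : ℝ) 1) := ⟨⟨0, by simp⟩⟩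
    refine ciSup_le fun s => ?_
    obtain ⟨j, hj⟩ := hA
    refine (Finset.inf'_le _ hj).trans (abs_le.2 ⟨?_, ?_⟩)
    · linarith [s.2.1, (hx j).2]
    · linarith [s.2.2, (hx j).1]
  · exact le_rfl

/-- An interval free of active sensors forces a coverage cost of at least half its length. -/
lemma le_coverageCost_of_gap {x : Fin n → ℝ} {A : Finset (Fin n)} {u v : ℝ} (hu : 0 ≤ u)
    (huv : u ≤ v) (hv : v ≤ 1) (h : ∀ i ∈ A, x i ∉ Set.Ico u v) :
    (v - u) / 2 ≤ coverageCost x A := by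
  rw [coverageCost]
  split_ifs with hA
  · refine le_ciSup_of_le (bddAbove_range_inf' x hA) ⟨(u + v) / 2, by constructor <;> linarith⟩ ?_
    refine Finset.le_inf' _ _ fun j hj => ?_
    have := h j hj
    rw [Set.mem_Ico, not_and, not_lt] at this
    rw [le_abs]
    rcases le_or_gt u (x j) with h1 | h1
    · right; linarith [this h1]
    · left; change _ ≤ (u + v) / 2 - x j; linarith
  · linarith

lemma exists_of_lt_coverageCost {x : Fin n → ℝ} {A : Finset (Fin n)} (hA : A.Nonempty) {t : ℝ}
    (h : t < coverageCost x A) : ∃ s ∈ Set.Icc (0 : ℝ) 1, ∀ j ∈ A, t < |s - x j| := by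
  rw [coverageCost, dif_pos hA] at h
  have : Nonempty (Set.Icc (0 : ℝ) 1) := ⟨⟨0, by simp⟩⟩
  obtain ⟨s, hs⟩ := exists_lt_of_lt_ciSup h
  exact ⟨s, s.2, fun j hj => (Finset.lt_inf'_iff _).1 hs j hj⟩

lemma measurable_coverageCost (A : Finset (Fin n)) :
    Measurable fun x : Fin n → ℝ => coverageCost x A := by
  simp only [coverageCost]
  split_ifs with hA
  -- The supremum is over an uncountable set, so measurability goes through semicontinuity: a
  -- supremum of continuous functions is lower semicontinuous.
  · refine LowerSemicontinuous.measurable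
      (lowerSemicontinuous_ciSup (fun x => bddAbove_range_inf' x hA) fun s => ?_)
    refine Continuous.lowerSemicontinuous ?_
    exact Continuous.finset_inf'_apply hA fun j _ => by fun_prop
  · exact measurable_const

/-- The `k`-th cell of the grid of mesh `1 / M`. -/
def cell (M k : ℕ) : Set ℝ := Set.Ico ((k : ℝ) / M) ((k + 1) / M)

/-- No active sensor lies in `B`. -/
def vacant (n : ℕ) (B : Set ℝ) : Set ((Fin n → ℝ) × Finset (Fin n)) :=
  {ω | ∀ i ∈ ω.2, ω.1 i ∉ B}

lemma biInter_vacant (F : ℕ → Set ℝ) (S : Finset ℕ) :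
    ⋂ k ∈ S, vacant n (F k) = vacant n (⋃ k ∈ S, F k) := by
  ext ω
  simp only [vacant, Set.mem_iInter, Set.mem_ofPred_eq, Set.mem_iUnion, not_exists]
  exact ⟨fun h i hi k hk => h k hk i hi, fun h k hk i hi => h i hi k hk⟩

lemma mem_cell_floor {M : ℕ} (hM : 0 < M) {y : ℝ} (hy : 0 ≤ y) : y ∈ cell M ⌊y * M⌋₊ := by
  have hM' : (0 : ℝ) < M := by exact_mod_cast hM
  rw [cell, Set.mem_Ico, div_le_iff₀ hM', lt_div_iff₀ hM']
  exact ⟨Nat.floor_le (by positivity), Nat.lt_floor_add_one _⟩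

lemma le_coverageCost_of_run {M L : ℕ} {ω : (Fin n → ℝ) × Finset (Fin n)}
    (h : ω ∈ ⋃ k ∈ Finset.range (M - L), ⋂ i ∈ Finset.Ico (k + 1) (k + 1 + L),
      vacant n (cell M i)) :
    (L : ℝ) / (2 * M) ≤ coverageCost ω.1 ω.2 := by
  simp only [Set.mem_iUnion, Finset.mem_range, Set.mem_iInter, Finset.mem_Ico] at h
  obtain ⟨k, hk, h⟩ := h
  have hM : 0 < M := by omega
  have hM' : (0 : ℝ) < M := by exact_mod_cast hM
  have hle : (k : ℝ) + 1 + L ≤ M := by exact_mod_cast (by omega : k + 1 + L ≤ M)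
  have := le_coverageCost_of_gap (x := ω.1) (A := ω.2) (u := ((k : ℝ) + 1) / M)
    (v := ((k : ℝ) + 1 + L) / M) (by positivity)
    (div_le_div_of_nonneg_right (le_add_of_nonneg_right L.cast_nonneg) hM'.le) ((div_le_one hM').2 hle) ?_
  · refine le_of_eq_of_le ?_ this
    field_simp; ring
  · rintro i hi ⟨h1, h2⟩
    have hy : 0 ≤ ω.1 i := le_trans (by positivity) h1
    rw [div_le_iff₀ hM'] at h1
    rw [lt_div_iff₀ hM'] at h2
    refine h ⌊ω.1 i * M⌋₊ ⟨Nat.le_floor (by exact_mod_cast h1), ?_⟩ i hi (mem_cell_floor hM hy)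
    rw [Nat.floor_lt (by positivity)]
    exact_mod_cast h2

/-- Some `s` has no active sensor within `t = j/(2n)`. If `[s-t, s+t]` lies in `[0,1]`, it has
length `j/n` and contains `j - 1` whole cells; otherwise it covers `[0,t]` or `[1-t,1]`, hence `j/2`
(rounded down) cells at an end. -/
lemma mem_of_lt_coverageCost (hn : 0 < n) {j : ℕ} (hj : j < 2 * n)
    {ω : (Fin n → ℝ) × Finset (Fin n)} (h : (j : ℝ) / (2 * n) < coverageCost ω.1 ω.2) :
    (ω ∈ ⋃ k ∈ (Finset.range (n + 1)).filter fun k => k + (j - 1) ≤ n,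
      ⋂ i ∈ Finset.Ico k (k + (j - 1)), vacant n (cell n i)) ∨
    (ω ∈ ⋂ i ∈ Finset.range (j / 2), vacant n (cell n i)) ∨
    ω ∈ ⋂ i ∈ Finset.Ico (n - j / 2) n, vacant n (cell n i) := by
  have hn' : (0 : ℝ) < n := by exact_mod_cast hn
  rcases ω.2.eq_empty_or_nonempty with hA | hA
  · right; left
    simp [vacant, hA]
  obtain ⟨s, ⟨hs0, hs1⟩, hs⟩ := exists_of_lt_coverageCost hA h
  set t : ℝ := (j : ℝ) / (2 * n) with ht
  have htn : t * n * 2 = j := by rw [ht]; field_simp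
  have hj2 : ((j / 2 : ℕ) : ℝ) ≤ t * n := by
    have : ((j / 2 : ℕ) : ℝ) ≤ j / 2 := Nat.cast_div_le
    linarith
  rcases lt_or_ge s t with hst | hst
  · right; left
    simp only [Set.mem_iInter, Finset.mem_range]
    rintro i hi a ha ⟨h1, h2⟩
    have h3 : (0 : ℝ) ≤ ω.1 a := le_trans (by positivity) h1
    have h4 : (i : ℝ) + 1 ≤ (j / 2 : ℕ) := by exact_mod_cast hi
    rw [lt_div_iff₀ hn'] at h2
    have h5 : ω.1 a < t := by nlinarith
    exact absurd (hs a ha) (not_lt.2 (abs_le.2 ⟨by linarith, by linarith⟩))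
  rcases lt_or_ge 1 (s + t) with hst' | hst'
  · right; right
    simp only [Set.mem_iInter, Finset.mem_Ico]
    rintro i ⟨hi1, hi2⟩ a ha ⟨h1, h2⟩
    rw [div_le_iff₀ hn'] at h1
    rw [lt_div_iff₀ hn'] at h2
    have h3 : (n : ℝ) ≤ i + (j / 2 : ℕ) := by exact_mod_cast (by omega : n ≤ i + j / 2)
    have h4 : (i : ℝ) + 1 ≤ n := by exact_mod_cast hi2
    have h5 : ω.1 a < 1 := by nlinarith
    have h6 : 1 - t ≤ ω.1 a := by nlinarith
    exact absurd (hs a ha) (not_lt.2 (abs_le.2 ⟨by linarith, by linarith⟩))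
  left
  have h0 : 0 ≤ (s - t) * n := mul_nonneg (by linarith) hn'.le
  have hk1 := Nat.le_ceil ((s - t) * n)
  have hk2 := Nat.ceil_lt_add_one h0
  set k := ⌈(s - t) * n⌉₊ with hk
  have hkj : k + (j - 1) ≤ n := by
    -- For `j = 0` the truncated `j - 1` is `0`, so the bound to show is `k ≤ n` instead of `k + j <
    -- n + 1`.
    rcases Nat.eq_zero_or_pos j with rfl | hj0
    · simp only [Nat.zero_sub, add_zero]
      refine Nat.ceil_le.2 ?_
      have : 0 ≤ t := by positivity
      nlinarith
    · have : (k : ℝ) + j < n + 1 := by nlinarith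
      have : k + j < n + 1 := by exact_mod_cast this
      omega
  simp only [Set.mem_iUnion, Set.mem_iInter, Finset.mem_Ico, Finset.mem_filter, Finset.mem_range]
  refine ⟨k, ⟨by omega, hkj⟩, ?_⟩
  rintro i ⟨hi1, hi2⟩ a ha ⟨h1, h2⟩
  rw [div_le_iff₀ hn'] at h1
  rw [lt_div_iff₀ hn'] at h2
  have h3 : (k : ℝ) ≤ i := by exact_mod_cast hi1
  have h4 : (i : ℝ) + 2 ≤ k + j := by exact_mod_cast (by omega : i + 2 ≤ k + j)
  have h5 : s - t ≤ ω.1 a := by nlinarith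
  have h6 : ω.1 a ≤ s + t := by nlinarith
  exact absurd (hs a ha) (not_lt.2 (abs_le.2 ⟨by linarith, by linarith⟩))

end Geometry

/-! ### The joint law of positions and failures -/

section Law

variable {n : ℕ} {p : ℝ}

/-- Law of the set of active sensors. -/
def activeMeasure (p : ℝ) (n : ℕ) : Measure (Finset (Fin n)) :=
  ∑ A : Finset (Fin n), ENNReal.ofReal (activeProb p A) • Measure.dirac A

lemma activeProb_nonneg (hp0 : 0 < p) (hp1 : p < 1) (A : Finset (Fin n)) : 0 ≤ activeProb p A :=
  mul_nonneg (pow_nonneg hp0.le _) (pow_nonneg (by linarith) _)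

lemma sum_activeProb (p : ℝ) (n : ℕ) : ∑ A : Finset (Fin n), activeProb p A = 1 := by
  have := Fintype.sum_pow_mul_eq_add_pow (Fin n) (1 - p) p
  simpa [activeProb, mul_comm] using this

lemma isProbabilityMeasure_activeMeasure (hp0 : 0 < p) (hp1 : p < 1) (n : ℕ) :
    IsProbabilityMeasure (activeMeasure p n) := by
  constructor
  simp only [activeMeasure, Measure.finsetSum_apply, Measure.smul_apply, measure_univ, smul_eq_mul,
    mul_one]
  rw [← ENNReal.ofReal_sum_of_nonneg fun A _ => activeProb_nonneg hp0 hp1 A, sum_activeProb,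
    ENNReal.ofReal_one]

lemma integral_activeMeasure (hp0 : 0 < p) (hp1 : p < 1) (f : Finset (Fin n) → ℝ) :
    ∫ A, f A ∂(activeMeasure p n) = ∑ A, activeProb p A * f A := by
  rw [activeMeasure, integral_finsetSum_measure]
  · refine Finset.sum_congr rfl fun A _ => ?_
    rw [integral_smul_measure, integral_dirac,
      ENNReal.toReal_ofReal (activeProb_nonneg hp0 hp1 A), smul_eq_mul]
  · intro A _
    exact (integrable_dirac (by simp)).smul_measure ENNReal.ofReal_ne_top

lemma measurableSet_vacant {B : Set ℝ} (hB : MeasurableSet B) :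
    MeasurableSet (vacant n B) := by
  have : vacant n B = ⋂ i : Fin n, ((fun ω : (Fin n → ℝ) × Finset (Fin n) => ω.2) ⁻¹' {A | i ∉ A}) ∪
      (fun ω : (Fin n → ℝ) × Finset (Fin n) => ω.1 i) ⁻¹' Bᶜ := by
    ext ω
    simp [vacant, imp_iff_not_or]
  rw [this]
  refine MeasurableSet.iInter fun i => ?_
  exact (measurable_snd (Set.toFinite _).measurableSet).union
    (((measurable_pi_apply i).comp measurable_fst) hB.compl)

/-- Failures are independent, and a sensor spoils the vacancy of `B` only if it is in `B` and
active. Expanding the product of `(1-p)(1 - 1_B) + p` over subsets recovers the sum over active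
sets. -/
lemma sum_activeProb_mul_indicator_vacant (p : ℝ) (x : Fin n → ℝ) (B : Set ℝ) :
    ∑ A, activeProb p A * (vacant n B).indicator 1 (x, A) =
      ∏ i, (1 - (1 - p) * B.indicator 1 (x i)) := by
  classical
  have h : ∀ i, 1 - (1 - p) * B.indicator (1 : ℝ → ℝ) (x i) =
      (1 - p) * (1 - B.indicator (1 : ℝ → ℝ) (x i)) + p := fun i => by ring
  simp only [h]
  rw [Finset.prod_add, Finset.powerset_univ]
  refine Finset.sum_congr rfl fun A _ => ?_
  rw [Finset.prod_mul_distrib, Finset.prod_const, Finset.prod_const, ← Finset.compl_eq_univ_sdiff,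
    Finset.card_compl, Fintype.card_fin, activeProb]
  have : (vacant n B).indicator (1 : (Fin n → ℝ) × Finset (Fin n) → ℝ) (x, A) =
      ∏ i ∈ A, (1 - B.indicator (1 : ℝ → ℝ) (x i)) := by
    by_cases hv : (x, A) ∈ vacant n B
    · rw [Set.indicator_of_mem hv, Finset.prod_eq_one]; · rfl
      intro i hi
      rw [Set.indicator_of_notMem (hv i hi), sub_zero]
    · rw [Set.indicator_of_notMem hv]
      simp only [vacant, Set.mem_ofPred_eq, not_forall, not_not] at hv
      obtain ⟨i, hi, hB⟩ := hv
      rw [Finset.prod_eq_zero hi]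
      rw [Set.indicator_of_mem hB, Pi.one_apply, sub_self]
  rw [this]; ring

lemma measureReal_vacant (hp0 : 0 < p) (hp1 : p < 1) (ν : Measure (Fin n → ℝ))
    [IsProbabilityMeasure ν] {B : Set ℝ} (hB : MeasurableSet B) :
    (ν.prod (activeMeasure p n)).real (vacant n B) =
      ∫ x, ∏ i, (1 - (1 - p) * B.indicator 1 (x i)) ∂ν := by
  have := isProbabilityMeasure_activeMeasure hp0 hp1 n
  rw [← integral_indicator_one (measurableSet_vacant hB), integral_prod]
  · simp only [integral_activeMeasure hp0 hp1, sum_activeProb_mul_indicator_vacant]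
  · exact (integrable_const (1 : ℝ)).indicator (measurableSet_vacant hB)

lemma measurable_uncurry_coverageCost :
    Measurable fun ω : (Fin n → ℝ) × Finset (Fin n) => coverageCost ω.1 ω.2 :=
  measurable_from_prod_countable_left fun A => measurable_coverageCost A

lemma ae_coverageCost_le_one {ν : Measure (Fin n → ℝ)}
    [IsProbabilityMeasure ν] (hν : ∀ᵐ x ∂ν, ∀ i, x i ∈ Set.Icc (0 : ℝ) 1) :
    ∀ᵐ ω ∂(ν.prod (activeMeasure p n)), coverageCost ω.1 ω.2 ≤ 1 := by
  have : ∀ᵐ ω ∂(ν.prod (activeMeasure p n)), ∀ i, ω.1 i ∈ Set.Icc (0 : ℝ) 1 :=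
    Measure.quasiMeasurePreserving_fst.ae hν
  filter_upwards [this] with ω hω using coverageCost_le_one hω _

lemma integrable_coverageCost (hp0 : 0 < p) (hp1 : p < 1) {ν : Measure (Fin n → ℝ)}
    [IsProbabilityMeasure ν] (hν : ∀ᵐ x ∂ν, ∀ i, x i ∈ Set.Icc (0 : ℝ) 1) :
    Integrable (fun ω => coverageCost ω.1 ω.2) (ν.prod (activeMeasure p n)) := by
  have := isProbabilityMeasure_activeMeasure hp0 hp1 n
  refine Integrable.of_bound measurable_uncurry_coverageCost.aestronglyMeasurable 1 ?_
  filter_upwards [ae_coverageCost_le_one hν] with ω hω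
  rwa [Real.norm_of_nonneg (coverageCost_nonneg _ _)]

lemma integral_averageCost (hp0 : 0 < p) (hp1 : p < 1) {ν : Measure (Fin n → ℝ)}
    [IsProbabilityMeasure ν] (hν : ∀ᵐ x ∂ν, ∀ i, x i ∈ Set.Icc (0 : ℝ) 1) :
    ∫ x, averageCost p x ∂ν =
      ∫ ω, coverageCost ω.1 ω.2 ∂(ν.prod (activeMeasure p n)) := by
  have := isProbabilityMeasure_activeMeasure hp0 hp1 n
  rw [integral_prod _ (integrable_coverageCost hp0 hp1 hν)]
  simp only [integral_activeMeasure hp0 hp1, averageCost]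

lemma measurable_averageCost : Measurable fun x : Fin n → ℝ => averageCost p x :=
  Finset.measurable_sum _ fun A _ => (measurable_coverageCost A).const_mul _

lemma integrable_averageCost (hp0 : 0 < p) (hp1 : p < 1) {ν : Measure (Fin n → ℝ)}
    [IsProbabilityMeasure ν] (hν : ∀ᵐ x ∂ν, ∀ i, x i ∈ Set.Icc (0 : ℝ) 1) :
    Integrable (fun x => averageCost p x) ν := by
  have := isProbabilityMeasure_activeMeasure hp0 hp1 n
  have := (integrable_coverageCost hp0 hp1 hν).integral_prod_left
  simp only [integral_activeMeasure hp0 hp1] at this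
  exact this

end Law

/-! ### Mean cost in terms of vacancy probabilities -/

section MeanCost

variable {n : ℕ} {p : ℝ}

lemma measurableSet_cell (M k : ℕ) : MeasurableSet (cell M k) := measurableSet_Ico

/-- Union bound over the at most `n + 1 ≤ 2n` interior runs and the two end runs. The factor `exp b`
pays for the lost cell in `j - 1` and for the rounding in `j / 2`. -/
lemma measureReal_lt_coverageCost_le (hp0 : 0 < p) (hp1 : p < 1) (hn : 0 < n)
    {ν : Measure (Fin n → ℝ)} [IsProbabilityMeasure ν]
    (hν : ∀ᵐ x ∂ν, ∀ i, x i ∈ Set.Icc (0 : ℝ) 1) {b : ℝ} (hb : 0 < b)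
    (hvac : ∀ S ⊆ Finset.range n, (ν.prod (activeMeasure p n)).real
      (⋂ k ∈ S, vacant n (cell n k)) ≤ Real.exp (-(b * S.card))) (j : ℕ) :
    (ν.prod (activeMeasure p n)).real {ω | (j : ℝ) < 2 * n * coverageCost ω.1 ω.2} ≤
      2 * Real.exp b * (n * Real.exp (-(b * j)) + Real.exp (-(b / 2 * j))) := by
  have := isProbabilityMeasure_activeMeasure hp0 hp1 n
  set μ := ν.prod (activeMeasure p n) with hμ
  have hn' : (0 : ℝ) < n := by exact_mod_cast hn
  have hn1 : (1 : ℝ) ≤ n := by exact_mod_cast hn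
  rcases le_or_gt (2 * n) j with hj | hj
  · have h0 : μ {ω | (j : ℝ) < 2 * n * coverageCost ω.1 ω.2} = 0 := by
      refine measure_eq_zero_iff_ae_notMem.2 ?_
      filter_upwards [ae_coverageCost_le_one hν] with ω hω
      have : (2 : ℝ) * n ≤ j := by exact_mod_cast hj
      simp only [not_lt]
      nlinarith
    rw [measureReal_def, h0, ENNReal.toReal_zero]
    positivity
  set K := (Finset.range (n + 1)).filter fun k => k + (j - 1) ≤ n with hK
  have hsub : {ω : (Fin n → ℝ) × Finset (Fin n) | (j : ℝ) < 2 * n * coverageCost ω.1 ω.2} ⊆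
      (⋃ k ∈ K, ⋂ i ∈ Finset.Ico k (k + (j - 1)), vacant n (cell n i)) ∪
      ((⋂ i ∈ Finset.range (j / 2), vacant n (cell n i)) ∪
        ⋂ i ∈ Finset.Ico (n - j / 2) n, vacant n (cell n i)) := by
    intro ω hω
    refine mem_of_lt_coverageCost hn hj ?_
    rw [div_lt_iff₀ (by positivity), mul_comm]
    exact hω
  have h1 : ∀ k ∈ K, μ.real (⋂ i ∈ Finset.Ico k (k + (j - 1)), vacant n (cell n i)) ≤
      Real.exp b * Real.exp (-(b * j)) := by
    intro k hk
    rw [hK, Finset.mem_filter] at hk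
    refine (hvac _ ?_).trans ?_
    · intro i; simp only [Finset.mem_Ico, Finset.mem_range]; omega
    · rw [Nat.card_Ico, ← Real.exp_add, Nat.add_sub_cancel_left]
      refine Real.exp_le_exp.2 ?_
      have : (j : ℝ) ≤ (j - 1 : ℕ) + 1 := by exact_mod_cast (by omega : j ≤ j - 1 + 1)
      nlinarith
  have hend : Real.exp (-(b * (j / 2 : ℕ))) ≤ Real.exp b * Real.exp (-(b / 2 * j)) := by
    rw [← Real.exp_add]
    refine Real.exp_le_exp.2 ?_
    have : (j : ℝ) ≤ 2 * (j / 2 : ℕ) + 1 := by exact_mod_cast (by omega : j ≤ 2 * (j / 2) + 1)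
    nlinarith
  have h2 : μ.real (⋂ i ∈ Finset.range (j / 2), vacant n (cell n i)) ≤
      Real.exp b * Real.exp (-(b / 2 * j)) := by
    refine (hvac _ (Finset.range_subset_range.2 (by omega))).trans ?_
    rwa [Finset.card_range]
  have h3 : μ.real (⋂ i ∈ Finset.Ico (n - j / 2) n, vacant n (cell n i)) ≤
      Real.exp b * Real.exp (-(b / 2 * j)) := by
    refine (hvac _ ?_).trans ?_
    · intro i; simp only [Finset.mem_Ico, Finset.mem_range]; omega
    · rwa [Nat.card_Ico, Nat.sub_sub_self (by omega)]
  have hcard : (K.card : ℝ) ≤ 2 * n := by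
    have : K.card ≤ n + 1 := (Finset.card_filter_le _ _).trans (by simp)
    have : (K.card : ℝ) ≤ n + 1 := by exact_mod_cast this
    linarith
  calc μ.real _ ≤ _ := measureReal_mono hsub
    _ ≤ ∑ k ∈ K, μ.real (⋂ i ∈ Finset.Ico k (k + (j - 1)), vacant n (cell n i)) +
        (Real.exp b * Real.exp (-(b / 2 * j)) + Real.exp b * Real.exp (-(b / 2 * j))) :=
      (measureReal_union_le _ _).trans (add_le_add (measureReal_biUnion_finset_le _ _)
        ((measureReal_union_le _ _).trans (add_le_add h2 h3)))
    _ ≤ 2 * n * (Real.exp b * Real.exp (-(b * j))) +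
        (Real.exp b * Real.exp (-(b / 2 * j)) + Real.exp b * Real.exp (-(b / 2 * j))) := by
      gcongr
      refine (Finset.sum_le_sum h1).trans ?_
      rw [Finset.sum_const, nsmul_eq_mul]
      gcongr
    _ = _ := by ring

lemma integral_averageCost_le (hp0 : 0 < p) (hp1 : p < 1) (hn : 1 ≤ n)
    {ν : Measure (Fin n → ℝ)} [IsProbabilityMeasure ν]
    (hν : ∀ᵐ x ∂ν, ∀ i, x i ∈ Set.Icc (0 : ℝ) 1) {b : ℝ} (hb : 0 < b)
    (hvac : ∀ S ⊆ Finset.range n, (ν.prod (activeMeasure p n)).real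
      (⋂ k ∈ S, vacant n (cell n k)) ≤ Real.exp (-(b * S.card))) :
    2 * n * ∫ x, averageCost p x ∂ν ≤ Real.log n / b + 2 * Real.exp b *
      (Real.exp b * (1 - Real.exp (-b))⁻¹ + (1 - Real.exp (-(b / 2)))⁻¹) := by
  have := isProbabilityMeasure_activeMeasure hp0 hp1 n
  rw [integral_averageCost hp0 hp1 hν, ← integral_const_mul]
  refine integral_le_of_tail (measurable_uncurry_coverageCost.const_mul _)
    ((integrable_coverageCost hp0 hp1 hν).const_mul _) (m := 2 * n) hn ?_ hb (by positivity)
    (measureReal_lt_coverageCost_le hp0 hp1 hn hν hb hvac)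
  filter_upwards [ae_coverageCost_le_one hν] with ω hω
  push_cast
  exact mul_le_of_le_one_right (by positivity) hω

/-- The factor `r` refines the grid without changing the levels: `j * r` cells of mesh `1/(n * r)`
still have length `j/n`. It is taken to be `n` for uniform positions and `1` for equispaced ones. -/
lemma le_integral_averageCost (hp0 : 0 < p) (hp1 : p < 1) (hn : 1 ≤ n)
    {ν : Measure (Fin n → ℝ)} [IsProbabilityMeasure ν]
    (hν : ∀ᵐ x ∂ν, ∀ i, x i ∈ Set.Icc (0 : ℝ) 1) {r : ℕ} (hr : 0 < r) {φ : ℕ → ℝ}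
    (hφ : ∀ S ⊆ Finset.range (n * r), (ν.prod (activeMeasure p n)).real
      (⋂ k ∈ S, vacant n (cell (n * r) k)) = φ S.card)
    {b D ε : ℝ} (hb : 0 < b) (hD : 0 ≤ D) (hε : 0 ≤ ε) (hεn : ε * Real.log n ≤ 1)
    (hrun : ∀ j : ℕ, b * j ≤ Real.log n → j < n ∧ 0 < φ (j * r) - φ (j * r + 1) ∧
      φ (2 * (j * r)) - 2 * φ (2 * (j * r) + 1) + φ (2 * (j * r) + 2) ≤
        (1 + ε) * (φ (j * r) - φ (j * r + 1)) ^ 2 ∧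
      1 / (((n * r : ℕ) - (j * r : ℕ) : ℝ) * (φ (j * r) - φ (j * r + 1))) ≤
        D * Real.exp (b * j) / n) :
    Real.log n / b - (1 + D * (1 - Real.exp (-b))⁻¹ + 1 / b) ≤
      2 * n * ∫ x, averageCost p x ∂ν := by
  have := isProbabilityMeasure_activeMeasure hp0 hp1 n
  have hn' : (0 : ℝ) < n := by exact_mod_cast hn
  have hr' : (0 : ℝ) < r := by exact_mod_cast hr
  rw [integral_averageCost hp0 hp1 hν, ← integral_const_mul]
  refine le_integral_of_tail (measurable_uncurry_coverageCost.const_mul _)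
    ((integrable_coverageCost hp0 hp1 hν).const_mul _)
    (fun ω => mul_nonneg (by positivity) (coverageCost_nonneg _ _)) hn hb hD hε hεn ?_
  intro j hj
  obtain ⟨hjn, hq, hq2, hle⟩ := hrun j hj
  have key := one_sub_le_measureReal_exists_run
    (fun k => measurableSet_vacant (measurableSet_cell (n * r) k)) hφ
    (L := j * r) (Nat.mul_lt_mul_of_pos_right hjn hr) hε hq hq2
  refine le_trans (by linarith) (key.trans (measureReal_mono ?_))
  intro ω hω
  have := le_coverageCost_of_run hω
  push_cast at this
  rw [mul_comm (2 : ℝ), mul_assoc (n : ℝ), mul_comm (r : ℝ), ← mul_assoc, mul_div_mul_right _ _ hr'.ne',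
    div_le_iff₀ (by positivity)] at this
  change (j : ℝ) ≤ 2 * n * coverageCost ω.1 ω.2
  linarith

end MeanCost

/-! ### Vacancy probabilities -/

section Vacancy

variable {n : ℕ} {p : ℝ}

lemma pairwise_disjoint_cell {M : ℕ} (hM : 0 < M) : Pairwise (Function.onFun Disjoint (cell M)) := by
  have hM' : (0 : ℝ) < M := by exact_mod_cast hM
  have key : ∀ k l : ℕ, k < l → Disjoint (cell M k) (cell M l) := by
    intro k l hkl
    rw [Set.disjoint_left]
    rintro y ⟨_, h2⟩ ⟨h3, _⟩
    have : ((k : ℝ) + 1) / M ≤ l / M := by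
      gcongr; exact_mod_cast hkl
    linarith
  intro k l hkl
  rcases hkl.lt_or_gt with h | h
  · exact key k l h
  · exact (key l k h).symm

/-- The uniform law on the unit interval. -/
def unitUniform : Measure ℝ := volume.restrict (Set.Icc 0 1)

instance : IsProbabilityMeasure unitUniform := ⟨by simp [unitUniform]⟩

lemma unitUniform_real_biUnion_cell {M : ℕ} (hM : 0 < M) {S : Finset ℕ}
    (hS : S ⊆ Finset.range M) :
    unitUniform.real (⋃ k ∈ S, cell M k) = S.card / M := by
  have hM' : (0 : ℝ) < M := by exact_mod_cast hM
  rw [measureReal_biUnion_finset (fun k _ l _ hkl => pairwise_disjoint_cell hM hkl)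
    fun k _ => measurableSet_cell M k, Finset.sum_congr rfl (g := fun _ => 1 / (M : ℝ))]
  · simp [div_eq_mul_inv]
  · intro k hk
    have hk' : (k : ℝ) + 1 ≤ M := by exact_mod_cast Finset.mem_range.1 (hS hk)
    have hsub : cell M k ⊆ Set.Icc 0 1 := by
      rintro y ⟨h1, h2⟩
      exact ⟨le_trans (by positivity) h1, h2.le.trans ((div_le_one hM').2 hk')⟩
    rw [measureReal_def, unitUniform, Measure.restrict_apply (measurableSet_cell M k),
      Set.inter_eq_left.2 hsub, cell, Real.volume_Ico, ← sub_div, add_sub_cancel_left,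
      ENNReal.toReal_ofReal (by positivity)]

lemma measureReal_vacant_uniform (hp0 : 0 < p) (hp1 : p < 1) {M : ℕ} (hM : 0 < M) {S : Finset ℕ}
    (hS : S ⊆ Finset.range M) :
    ((Measure.pi fun _ : Fin n => unitUniform).prod (activeMeasure p n)).real
      (⋂ k ∈ S, vacant n (cell M k)) = (1 - (1 - p) * S.card / M) ^ n := by
  have hB : MeasurableSet (⋃ k ∈ S, cell M k) :=
    Finset.measurableSet_biUnion _ fun k _ => measurableSet_cell M k
  rw [biInter_vacant, measureReal_vacant hp0 hp1 _ hB,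
    integral_fintype_prod_eq_pow (fun y : ℝ => 1 - (1 - p) * (⋃ k ∈ S, cell M k).indicator 1 y),
    Fintype.card_fin]
  congr 1
  have hi : Integrable ((⋃ k ∈ S, cell M k).indicator (1 : ℝ → ℝ)) unitUniform :=
    (integrable_const (1 : ℝ)).indicator hB
  rw [integral_sub (integrable_const _) (hi.const_mul _), integral_const_mul,
    integral_indicator_one hB, unitUniform_real_biUnion_cell hM hS]
  simp [mul_div_assoc]

lemma equispaced_mem_cell_iff (i : Fin n) (k : ℕ) : equispaced n i ∈ cell n k ↔ (i : ℕ) = k := by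
  have hn : 0 < n := i.pos
  have hn' : (0 : ℝ) < n := by exact_mod_cast hn
  rw [cell, equispaced, Set.mem_Ico, div_le_div_iff₀ hn' (by positivity),
    div_lt_div_iff₀ (by positivity) hn']
  constructor
  · rintro ⟨h1, h2⟩
    have h3 : (2 * k : ℝ) ≤ 2 * (i : ℕ) + 1 := by nlinarith
    have h4 : (2 * (i : ℕ) + 1 : ℝ) < 2 * (k + 1) := by nlinarith
    have h5 : 2 * k ≤ 2 * (i : ℕ) + 1 := by exact_mod_cast h3
    have h6 : 2 * (i : ℕ) + 1 < 2 * (k + 1) := by exact_mod_cast h4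
    omega
  · rintro rfl
    constructor <;> nlinarith

lemma equispaced_mem_Icc (i : Fin n) : equispaced n i ∈ Set.Icc (0 : ℝ) 1 := by
  have hn' : (0 : ℝ) < n := by exact_mod_cast i.pos
  have hi : ((i : ℕ) : ℝ) + 1 ≤ n := by exact_mod_cast i.2
  rw [equispaced]
  exact ⟨by positivity, (div_le_one (by positivity)).2 (by linarith)⟩

lemma measureReal_vacant_equispaced (hp0 : 0 < p) (hp1 : p < 1) {S : Finset ℕ}
    (hS : S ⊆ Finset.range n) :
    ((Measure.dirac (equispaced n)).prod (activeMeasure p n)).real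
      (⋂ k ∈ S, vacant n (cell n k)) = p ^ S.card := by
  have hB : MeasurableSet (⋃ k ∈ S, cell n k) :=
    Finset.measurableSet_biUnion _ fun k _ => measurableSet_cell n k
  rw [biInter_vacant, measureReal_vacant hp0 hp1 _ hB, integral_dirac]
  have h : ∀ i : Fin n, 1 - (1 - p) * (⋃ k ∈ S, cell n k).indicator (1 : ℝ → ℝ) (equispaced n i) =
      if (i : ℕ) ∈ S then p else 1 := by
    intro i
    have hmem : equispaced n i ∈ ⋃ k ∈ S, cell n k ↔ (i : ℕ) ∈ S := by
      simp [equispaced_mem_cell_iff]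
    split_ifs with hi
    · rw [Set.indicator_of_mem (hmem.2 hi), Pi.one_apply]; ring
    · rw [Set.indicator_of_notMem (fun h => hi (hmem.1 h))]; ring
  rw [Finset.prod_congr rfl fun i _ => h i,
    Fin.prod_univ_eq_prod_range (fun i => if i ∈ S then p else 1) n, Finset.prod_ite_mem,
    Finset.prod_const, Finset.inter_eq_right.2 hS]

end Vacancy

/-! ### Finite differences of powers -/

section Powers

lemma mul_pow_le_pow_succ_sub {u v : ℝ} (hv : 0 ≤ v) (huv : v ≤ u) (m : ℕ) :
    (m + 1) * (u - v) * v ^ m ≤ u ^ (m + 1) - v ^ (m + 1) := by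
  induction m with
  | zero => simp
  | succ m ih =>
    have h1 : 0 ≤ (m + 1) * (u - v) * v ^ m :=
      mul_nonneg (mul_nonneg (by positivity) (by linarith)) (by positivity)
    have h2 := mul_le_mul huv ih h1 (hv.trans huv)
    push_cast
    calc ((m : ℝ) + 1 + 1) * (u - v) * v ^ (m + 1)
        = v * ((m + 1) * (u - v) * v ^ m) + (u - v) * v ^ (m + 1) := by ring
      _ ≤ u * (u ^ (m + 1) - v ^ (m + 1)) + (u - v) * v ^ (m + 1) := by gcongr
      _ = _ := by ring

lemma pow_succ_sub_le_mul_pow {u v : ℝ} (hv : 0 ≤ v) (huv : v ≤ u) (m : ℕ) :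
    u ^ (m + 1) - v ^ (m + 1) ≤ (m + 1) * (u - v) * u ^ m := by
  induction m with
  | zero => simp
  | succ m ih =>
    have h1 : v ^ (m + 1) ≤ u ^ (m + 1) := pow_le_pow_left₀ hv huv _
    have h2 := mul_le_mul_of_nonneg_left ih (hv.trans huv)
    have h3 := mul_le_mul_of_nonneg_left h1 (sub_nonneg.2 huv)
    push_cast
    calc u ^ (m + 1 + 1) - v ^ (m + 1 + 1)
        = u * (u ^ (m + 1) - v ^ (m + 1)) + (u - v) * v ^ (m + 1) := by ring
      _ ≤ u * ((m + 1) * (u - v) * u ^ m) + (u - v) * u ^ (m + 1) := add_le_add h2 h3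
      _ = _ := by ring

/-- Discrete form of bounding a second difference by `h²` times the second derivative at the largest
point `u`. -/
lemma second_difference_pow_le {u h : ℝ} (hh : 0 ≤ h) (hu : 2 * h ≤ u) (m : ℕ) :
    u ^ (m + 2) - 2 * (u - h) ^ (m + 2) + (u - 2 * h) ^ (m + 2) ≤
      (m + 2) * (m + 1) * h ^ 2 * u ^ m := by
  induction m with
  | zero => apply le_of_eq; push_cast; ring
  | succ m ih =>
    have h1 := pow_succ_sub_le_mul_pow (u := u - h) (v := u - 2 * h) (by linarith) (by linarith)
      (m + 1)
    have h2 : (u - h) ^ (m + 1) ≤ u ^ (m + 1) := pow_le_pow_left₀ (by linarith) (by linarith) _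
    have h3 : (0 : ℝ) ≤ 2 * h * ((m + 2) * h) := by positivity
    push_cast at h1 ⊢
    calc u ^ (m + 1 + 2) - 2 * (u - h) ^ (m + 1 + 2) + (u - 2 * h) ^ (m + 1 + 2)
        = u * (u ^ (m + 2) - 2 * (u - h) ^ (m + 2) + (u - 2 * h) ^ (m + 2)) +
          2 * h * ((u - h) ^ (m + 1 + 1) - (u - 2 * h) ^ (m + 1 + 1)) := by ring
      _ ≤ u * ((m + 2) * (m + 1) * h ^ 2 * u ^ m) +
          2 * h * ((m + 1 + 1) * (u - h - (u - 2 * h)) * (u - h) ^ (m + 1)) := by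
          gcongr
          linarith
      _ = u * ((m + 2) * (m + 1) * h ^ 2 * u ^ m) +
          2 * h * ((m + 2) * h) * (u - h) ^ (m + 1) := by ring
      _ ≤ u * ((m + 2) * (m + 1) * h ^ 2 * u ^ m) + 2 * h * ((m + 2) * h) * u ^ (m + 1) := by
          gcongr
      _ = _ := by ring

lemma exp_neg_le_one_sub {z : ℝ} (hz0 : 0 ≤ z) (hz : z ≤ 1 / 2) :
    Real.exp (-(z + 2 * z ^ 2)) ≤ 1 - z := by
  have h : 0 < 1 - z := by linarith
  rw [← Real.le_log_iff_exp_le h]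
  refine le_trans ?_ (Real.one_sub_inv_le_log_of_pos h)
  rw [le_sub_comm, inv_le_iff_one_le_mul₀ h]
  nlinarith [mul_nonneg hz0 hz0, mul_nonneg (mul_nonneg hz0 hz0) (by linarith : 0 ≤ 1 / 2 - z)]

/-- Compares the joint vacancy of two runs with the square of a single one. It rests on `1 - 2y ≤
(1-y)²` and `(1-y)(1-2h) ≤ 1-y-h`; the spare factor `1 - 2y` and Bernoulli's inequality for `1 - 2h`
lose at most `1 - δ`, and `(1+2δ)(1-δ) ≥ 1`. -/
lemma one_sub_two_mul_pow_le {y h δ : ℝ} {m : ℕ} (hy0 : 0 ≤ y) (hy1 : y ≤ 1 / 2) (hh0 : 0 ≤ h)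
    (hh1 : h ≤ 1 / 2) (hδ2 : 2 * y + 4 * h * (m + 2) ≤ δ) (hδ0 : 0 ≤ δ) (hδ1 : δ ≤ 1 / 2) :
    (1 - 2 * y) ^ m ≤ (1 + 2 * δ) * (1 - y - h) ^ (2 * (m + 1)) := by
  have hu : 0 ≤ (1 - 2 * y) ^ m := pow_nonneg (by linarith) m
  obtain ⟨N, hNm⟩ : ∃ N : ℝ, N = m + 2 := ⟨_, rfl⟩
  rw [← hNm] at hδ2
  have hN0 : 0 < N := by rw [hNm]; positivity
  have hbern : 1 - 4 * h * N ≤ (1 - 2 * h) ^ (2 * (m + 1)) := by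
    have := one_add_mul_le_pow (a := -(2 * h)) (by linarith) (2 * (m + 1))
    push_cast at this
    rw [← sub_eq_add_neg] at this
    refine le_trans ?_ this
    rw [hNm]; nlinarith
  have hprod : (1 - 2 * y) ^ m * (1 - 2 * y) * (1 - 4 * h * N) ≤
      (1 - y - h) ^ (2 * (m + 1)) := by
    calc (1 - 2 * y) ^ m * (1 - 2 * y) * (1 - 4 * h * N)
        ≤ ((1 - y) ^ 2) ^ (m + 1) * (1 - 2 * h) ^ (2 * (m + 1)) := by
          rw [← pow_succ]
          refine mul_le_mul ?_ hbern (by linarith) (by positivity)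
          exact pow_le_pow_left₀ (by linarith) (by nlinarith) _
      _ = ((1 - y) * (1 - 2 * h)) ^ (2 * (m + 1)) := by rw [← pow_mul, mul_pow]
      _ ≤ _ := pow_le_pow_left₀ (mul_nonneg (by linarith) (by linarith)) (by nlinarith) _
  calc (1 - 2 * y) ^ m ≤ (1 - 2 * y) ^ m * ((1 + 2 * δ) * (1 - δ)) :=
        le_mul_of_one_le_right hu (by nlinarith)
    _ ≤ (1 - 2 * y) ^ m * ((1 + 2 * δ) * ((1 - 2 * y) * (1 - 4 * h * N))) := by
        gcongr
        have : 0 ≤ y * (h * N) := by positivity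
        nlinarith
    _ = (1 + 2 * δ) * ((1 - 2 * y) ^ m * (1 - 2 * y) * (1 - 4 * h * N)) := by ring
    _ ≤ _ := by gcongr

/-- The binomial vacancy probabilities on the grid of mesh `n⁻²` satisfy the hypotheses of the
second moment bound, for runs of length `j / n` with `a j ≤ log n`. -/
lemma binomial_run_bounds {a : ℝ} (ha0 : 0 < a) (ha1 : a ≤ 1) {n : ℕ} (hn : 2 ≤ n)
    (hlog : 16 * (Real.log n + 1) ^ 2 ≤ a * n) {φ : ℕ → ℝ}
    (hφ : ∀ s : ℕ, φ s = (1 - a * s / (n * n : ℕ)) ^ n) {j : ℕ} (hj : a * j ≤ Real.log n) :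
    j < n ∧ 0 < φ (j * n) - φ (j * n + 1) ∧
      φ (2 * (j * n)) - 2 * φ (2 * (j * n) + 1) + φ (2 * (j * n) + 2) ≤
        (1 + (4 * Real.log n + 8) / n) * (φ (j * n) - φ (j * n + 1)) ^ 2 ∧
      1 / (((n * n : ℕ) - (j * n : ℕ) : ℝ) * (φ (j * n) - φ (j * n + 1))) ≤
        2 * Real.exp 2 / a * Real.exp (a * j) / n := by
  obtain ⟨m, hnm⟩ := Nat.exists_eq_add_of_le' hn
  have hl0 : 0 ≤ Real.log n := Real.log_natCast_nonneg n
  obtain ⟨l, hl⟩ : ∃ l, l = Real.log n := ⟨_, rfl⟩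
  rw [← hl] at hlog hj hl0 ⊢
  obtain ⟨N, hN⟩ : ∃ N : ℝ, N = n := ⟨_, rfl⟩
  rw [← hN] at hlog ⊢
  have hNm : N = m + 2 := by rw [hN, hnm]; push_cast; ring
  have hN0 : 0 < N := by rw [hNm]; positivity
  have hlN : 16 * (l + 1) ^ 2 ≤ N := hlog.trans (mul_le_of_le_one_left hN0.le ha1)
  have hl1 : (l + 1) ≤ (l + 1) ^ 2 := by nlinarith
  have hN16 : 16 ≤ N := by linarith
  have hj0 : (0 : ℝ) ≤ j := j.cast_nonneg
  have hjN : (j : ℝ) ≤ N / 2 := by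
    have : a * j ≤ a * (N / 2) := by linarith
    exact le_of_mul_le_mul_left this ha0
  have hjn : j < n := by
    have : (j : ℝ) < n := by linarith
    exact_mod_cast this
  -- `h` is the expected share of one fine cell and `y` that of a run of length `j/n`, thinned by
  -- `a`.
  set h : ℝ := a / N ^ 2 with hh
  set y : ℝ := a * j / N with hy
  have hh0 : 0 < h := by positivity
  have hy0 : 0 ≤ y := by positivity
  have hyN : y * N = a * j := by rw [hy]; field_simp
  have hhN : h * N * N = a := by rw [hh]; field_simp
  have hhN1 : h * N ≤ 1 / 16 := by
    have : h * N = a / N := by rw [hh]; field_simp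
    rw [this, div_le_iff₀ hN0]; linarith
  have hh1 : h ≤ 1 / 256 := by
    have : h * 16 ≤ h * N := mul_le_mul_of_nonneg_left hN16 hh0.le
    linarith
  have hy1 : y ≤ 1 / 16 := by rw [hy, div_le_iff₀ hN0]; linarith
  have e1 : φ (j * n) = (1 - y) ^ (m + 2) := by
    rw [hφ, ← hnm]; push_cast; rw [← hN, hy]; congr 2; field_simp
  have e2 : φ (j * n + 1) = (1 - y - h) ^ (m + 2) := by
    rw [hφ, ← hnm]; push_cast; rw [← hN, hy, hh]; congr 1; field_simp; ring
  have e3 : φ (2 * (j * n)) = (1 - 2 * y) ^ (m + 2) := by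
    rw [hφ, ← hnm]; push_cast; rw [← hN, hy]; congr 2; field_simp
  have e4 : φ (2 * (j * n) + 1) = (1 - 2 * y - h) ^ (m + 2) := by
    rw [hφ, ← hnm]; push_cast; rw [← hN, hy, hh]; congr 1; field_simp; ring
  have e5 : φ (2 * (j * n) + 2) = (1 - 2 * y - 2 * h) ^ (m + 2) := by
    rw [hφ, ← hnm]; push_cast; rw [← hN, hy, hh]; congr 1; field_simp; ring
  have hz0 : 0 < 1 - y - h := by linarith
  set q := φ (j * n) - φ (j * n + 1) with hq
  have hqlow : N * h * (1 - y - h) ^ (m + 1) ≤ q := by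
    have := mul_pow_le_pow_succ_sub (u := 1 - y) (v := 1 - y - h) hz0.le (by linarith) (m + 1)
    rw [hq, e1, e2, hNm]
    push_cast at this
    refine le_trans (le_of_eq ?_) this
    ring
  have hlow0 : 0 < N * h * (1 - y - h) ^ (m + 1) := by positivity
  have hq0 : 0 < q := hlow0.trans_le hqlow
  refine ⟨hjn, hq0, ?_, ?_⟩
  · have hq2 : (N * h) ^ 2 * (1 - y - h) ^ (2 * (m + 1)) ≤ q ^ 2 := by
      calc _ = (N * h * (1 - y - h) ^ (m + 1)) ^ 2 := by ring
        _ ≤ q ^ 2 := pow_le_pow_left₀ hlow0.le hqlow 2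
    have hD := second_difference_pow_le (u := 1 - 2 * y) hh0.le (by linarith) m
    have hu : 0 ≤ (1 - 2 * y) ^ m := pow_nonneg (by linarith) m
    set δ : ℝ := (2 * l + 4) / N with hδ
    have hδ0 : 0 ≤ δ := by positivity
    have hδ1 : δ ≤ 1 / 2 := by rw [hδ, div_le_iff₀ hN0]; linarith
    have hδe : (4 * l + 8) / N = 2 * δ := by rw [hδ]; ring
    have hδ2 : 2 * y + 4 * h * N ≤ δ := by
      have : (2 * y + 4 * h * N) * N ≤ 2 * l + 4 := by
        rw [show (2 * y + 4 * h * N) * N = 2 * (y * N) + 4 * (h * N * N) by ring, hyN, hhN]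
        linarith
      rw [hδ, le_div_iff₀ hN0]; exact this
    have h1 := one_sub_two_mul_pow_le hy0 (by linarith) hh0.le (by linarith) (by rw [← hNm]; exact hδ2)
      hδ0 hδ1
    rw [e3, e4, e5, hδe]
    calc _ ≤ _ := hD
      _ ≤ (N * h) ^ 2 * (1 - 2 * y) ^ m := by
          rw [mul_pow]
          have : ((m : ℝ) + 2) * (m + 1) ≤ N ^ 2 := by
            rw [hNm]; nlinarith [(m.cast_nonneg : (0 : ℝ) ≤ m)]
          gcongr
      _ ≤ (N * h) ^ 2 * ((1 + 2 * δ) * (1 - y - h) ^ (2 * (m + 1))) := by gcongr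
      _ = (1 + 2 * δ) * ((N * h) ^ 2 * (1 - y - h) ^ (2 * (m + 1))) := by ring
      _ ≤ _ := by gcongr
  -- The 2 in the exponent covers `h * N ≤ 1` and the quadratic error `2N(y+h)² ≤ 1`, the latter by
  -- `hlN`.
  · have hexp : Real.exp (-(a * j + 2)) ≤ (1 - y - h) ^ (m + 2) := by
      have hz := exp_neg_le_one_sub (z := y + h) (by linarith) (by linarith)
      have hp := pow_le_pow_left₀ (Real.exp_pos _).le hz (m + 2)
      rw [← Real.exp_nat_mul, ← sub_sub] at hp
      refine le_trans (Real.exp_le_exp.2 ?_) hp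
      rw [← hnm, ← hN]
      have h0 : N * (y + h) = y * N + h * N := by ring
      have h1 : N * (y + h) ≤ l + 1 := by rw [h0, hyN]; linarith
      have h2 : (N * (y + h)) ^ 2 ≤ (l + 1) ^ 2 := pow_le_pow_left₀ (by positivity) h1 2
      have h3 : N * (2 * (y + h) ^ 2) ≤ 1 := by
        have : N * (N * (2 * (y + h) ^ 2)) ≤ N * 1 := by
          rw [show N * (N * (2 * (y + h) ^ 2)) = 2 * (N * (y + h)) ^ 2 by ring]
          linarith
        exact le_of_mul_le_mul_left this hN0
      have h4 : N * -(y + h + 2 * (y + h) ^ 2) = -(y * N + h * N + N * (2 * (y + h) ^ 2)) := by ring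
      rw [h4, hyN]
      linarith
    -- At least `N²/2` starting places remain since `j ≤ N/2`, and `h * N² = a`; this yields the
    -- constant `2 * exp 2 / a`.
    have hX : N * a / 2 * Real.exp (-(a * j + 2)) ≤ (N * N - j * N) * q := by
      calc N * a / 2 * Real.exp (-(a * j + 2)) ≤ N * a / 2 * (1 - y - h) ^ (m + 1) := by
            gcongr
            refine hexp.trans (pow_le_pow_of_le_one hz0.le (by linarith) (by omega))
        _ = N ^ 2 / 2 * (N * h * (1 - y - h) ^ (m + 1)) := by rw [← hhN]; ring
        _ ≤ (N * N - j * N) * q := by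
            have : j * N ≤ N / 2 * N := mul_le_mul_of_nonneg_right hjN hN0.le
            have h2 : N ^ 2 / 2 ≤ N * N - j * N := by linarith [sq N]
            exact mul_le_mul h2 hqlow hlow0.le (le_trans (by positivity) h2)
    push_cast
    rw [← hN]
    calc 1 / ((N * N - j * N) * q) ≤ 1 / (N * a / 2 * Real.exp (-(a * j + 2))) :=
          one_div_le_one_div_of_le (by positivity) hX
      _ = _ := by
          rw [Real.exp_neg, Real.exp_add]; field_simp

end Powers

/-! ### Asymptotics of the mean cost -/

section Asymptotics

variable {p : ℝ}

lemma eventually_log_sq_le {c : ℝ} (hc : 0 < c) :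
    ∀ᶠ n : ℕ in atTop, 16 * (Real.log n + 1) ^ 2 ≤ c * n := by
  -- `64 = 16 * 4`, as `(log n + 1)² ≤ 4 (log n)²` once `log n ≥ 1`.
  have h1 := (Real.isLittleO_pow_log_id_atTop (n := 2)).bound (show 0 < c / 64 by positivity)
  have h2 := Real.tendsto_log_atTop.eventually_ge_atTop 1
  filter_upwards [tendsto_natCast_atTop_atTop.eventually (h1.and h2)] with n hn
  obtain ⟨h3, h4⟩ := hn
  rw [Real.norm_of_nonneg (by positivity), id, Real.norm_of_nonneg (by positivity)] at h3
  nlinarith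

lemma isBigO_of_eventually_bounds {f : ℕ → ℝ} {b K₁ K₂ : ℝ}
    (h : ∀ᶠ n : ℕ in atTop, Real.log n / b - K₁ ≤ 2 * n * f n ∧ 2 * n * f n ≤ Real.log n / b + K₂) :
    (fun n : ℕ => f n - 1 / (2 * b) * (Real.log n / n)) =O[atTop] fun n : ℕ => 1 / (n : ℝ) := by
  refine IsBigO.of_bound ((|K₁| + |K₂|) / 2) ?_
  filter_upwards [h, eventually_gt_atTop 0] with n hn hn0
  have hn' : (0 : ℝ) < n := by exact_mod_cast hn0
  have e : f n - 1 / (2 * b) * (Real.log n / n) = (2 * n * f n - Real.log n / b) / 2 * (1 / n) := by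
    have h1 : f n = 2 * n * f n / 2 * (1 / n) := by field_simp
    have h2 : 1 / (2 * b) * (Real.log n / n) = Real.log n / b / 2 * (1 / n) := by ring
    rw [h2, sub_div, sub_mul, ← h1]
  rw [e, norm_mul]
  gcongr
  rw [Real.norm_eq_abs, abs_div, abs_two]
  gcongr
  rw [abs_le]
  constructor <;> linarith [hn.1, hn.2, le_abs_self K₁, le_abs_self K₂, abs_nonneg K₁, abs_nonneg K₂]

lemma ae_pi_unitUniform_mem_Icc (n : ℕ) :
    ∀ᵐ x ∂(Measure.pi fun _ : Fin n => unitUniform), ∀ i, x i ∈ Set.Icc (0 : ℝ) 1 := by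
  rw [ae_all_iff]
  intro i
  exact (Measure.quasiMeasurePreserving_eval (fun _ : Fin n => unitUniform) i).ae
    (ae_restrict_mem measurableSet_Icc)

lemma uniform_mean_bounds (hp0 : 0 < p) (hp1 : p < 1) {n : ℕ} (hn : 2 ≤ n)
    (hlog : 16 * (Real.log n + 1) ^ 2 ≤ (1 - p) * n) :
    Real.log n / (1 - p) - (1 + 2 * Real.exp 2 / (1 - p) * (1 - Real.exp (-(1 - p)))⁻¹ +
      1 / (1 - p)) ≤
        2 * n * ∫ x, averageCost p x ∂(Measure.pi fun _ : Fin n => unitUniform) ∧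
    2 * n * ∫ x, averageCost p x ∂(Measure.pi fun _ : Fin n => unitUniform) ≤
      Real.log n / (1 - p) + 2 * Real.exp (1 - p) * (Real.exp (1 - p) *
        (1 - Real.exp (-(1 - p)))⁻¹ + (1 - Real.exp (-((1 - p) / 2)))⁻¹) := by
  have ha0 : 0 < 1 - p := by linarith
  have hn0 : 0 < n := by omega
  have hn' : (0 : ℝ) < n := by exact_mod_cast hn0
  have hl0 : 0 ≤ Real.log n := Real.log_natCast_nonneg n
  have hν := ae_pi_unitUniform_mem_Icc n
  constructor
  · refine le_integral_averageCost hp0 hp1 hn0 hν hn0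
      (φ := fun s => (1 - (1 - p) * s / (n * n : ℕ)) ^ n)
      (fun S hS => measureReal_vacant_uniform hp0 hp1 (Nat.mul_pos hn0 hn0) hS) ha0
      (ε := (4 * Real.log n + 8) / n) (by positivity) (by positivity) ?_
      fun j hj => binomial_run_bounds ha0 (by linarith) hn hlog (fun _ => rfl) hj
    rw [div_mul_eq_mul_div, div_le_one hn']
    nlinarith
  · refine integral_averageCost_le hp0 hp1 hn0 hν ha0 fun S hS => ?_
    rw [measureReal_vacant_uniform hp0 hp1 hn0 hS]
    have hc : (S.card : ℝ) ≤ n := by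
      have := Finset.card_le_card hS
      rw [Finset.card_range] at this
      exact_mod_cast this
    have h1 : (1 - p) * S.card / n ≤ 1 := by
      rw [div_le_one hn']
      exact (mul_le_of_le_one_left (Nat.cast_nonneg _) (by linarith)).trans hc
    calc (1 - (1 - p) * S.card / n) ^ n ≤ Real.exp (-((1 - p) * S.card / n)) ^ n :=
          pow_le_pow_left₀ (by linarith) (Real.one_sub_le_exp_neg _) n
      _ = _ := by
          rw [← Real.exp_nat_mul]; congr 1; field_simp

lemma exp_neg_log_inv_mul (hp0 : 0 < p) (k : ℕ) : Real.exp (-(Real.log p⁻¹ * k)) = p ^ k := by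
  rw [Real.log_inv, neg_mul, neg_neg, mul_comm, Real.exp_nat_mul, Real.exp_log hp0]

lemma equispaced_mean_bounds (hp0 : 0 < p) (hp1 : p < 1) {n : ℕ} (hn : 1 ≤ n)
    (hlog : 2 * Real.log n ≤ Real.log p⁻¹ * n) :
    Real.log n / Real.log p⁻¹ - (1 + 2 / (1 - p) * (1 - Real.exp (-Real.log p⁻¹))⁻¹ +
      1 / Real.log p⁻¹) ≤ 2 * n * averageCost p (equispaced n) ∧
    2 * n * averageCost p (equispaced n) ≤
      Real.log n / Real.log p⁻¹ + 2 * Real.exp (Real.log p⁻¹) * (Real.exp (Real.log p⁻¹) *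
        (1 - Real.exp (-Real.log p⁻¹))⁻¹ + (1 - Real.exp (-(Real.log p⁻¹ / 2)))⁻¹) := by
  have hb : 0 < Real.log p⁻¹ := Real.log_pos ((one_lt_inv₀ hp0).2 hp1)
  have ha0 : 0 < 1 - p := by linarith
  have hn' : (0 : ℝ) < n := by exact_mod_cast hn
  have hν : ∀ᵐ x ∂(Measure.dirac (equispaced n)), ∀ i, x i ∈ Set.Icc (0 : ℝ) 1 := by
    rw [ae_all_iff]
    intro i
    rw [ae_dirac_iff (measurableSet_Icc.preimage (measurable_pi_apply i))]
    exact equispaced_mem_Icc i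
  have hint : averageCost p (equispaced n) =
      ∫ x, averageCost p x ∂(Measure.dirac (equispaced n)) := by rw [integral_dirac]
  rw [hint]
  constructor
  -- Each cell holds exactly one sensor, so vacancies are independent: the second difference of `p ^
  -- s` equals `q²` exactly and `ε = 0` works on the unrefined grid.
  · refine le_integral_averageCost hp0 hp1 hn hν one_pos (φ := fun s => p ^ s)
      (fun S hS => ?_) hb (ε := 0) (by positivity) le_rfl (by simp) ?_
    · rw [mul_one] at hS ⊢
      exact measureReal_vacant_equispaced hp0 hp1 hS
    · intro j hj
      have hj2 : (j : ℝ) ≤ n / 2 := by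
        have : Real.log p⁻¹ * j ≤ Real.log p⁻¹ * (n / 2) := by linarith
        exact le_of_mul_le_mul_left this hb
      have hq : p ^ (j * 1) - p ^ (j * 1 + 1) = p ^ j * (1 - p) := by rw [mul_one]; ring
      have hexp : Real.exp (Real.log p⁻¹ * j) = (p ^ j)⁻¹ := by
        rw [← exp_neg_log_inv_mul hp0, ← Real.exp_neg, neg_neg]
      have hpj : 0 < p ^ j := pow_pos hp0 j
      refine ⟨?_, ?_, ?_, ?_⟩
      · have : (j : ℝ) < n := by linarith
        exact_mod_cast this
      · rw [hq]; positivity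
      · rw [hq, mul_one]; apply le_of_eq; ring
      · rw [hq, hexp, mul_one, mul_one]
        calc 1 / (((n : ℝ) - j) * (p ^ j * (1 - p))) ≤ 1 / (n / 2 * (p ^ j * (1 - p))) := by
              gcongr; linarith
          _ = _ := by field_simp
  · refine integral_averageCost_le hp0 hp1 hn hν hb fun S hS => ?_
    rw [measureReal_vacant_equispaced hp0 hp1 hS, exp_neg_log_inv_mul hp0]

lemma map_eq_pi_unitUniform {Ω : Type*} [MeasurableSpace Ω] {P : Measure Ω}
    [IsProbabilityMeasure P] {n : ℕ} {X : Fin n → Ω → ℝ} (hmeas : ∀ i, AEMeasurable (X i) P)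
    (hunif : ∀ i, pdf.IsUniform (X i) (Set.Icc (0 : ℝ) 1) P volume) (hindep : iIndepFun X P) :
    P.map (fun ω i => X i ω) = Measure.pi fun _ : Fin n => unitUniform := by
  rw [(iIndepFun_iff_map_fun_eq_pi_map hmeas).1 hindep]
  congr 1
  funext i
  rw [hunif i, ProbabilityTheory.cond, unitUniform]
  simp

end Asymptotics

end

theorem mainTheorem2 {p : ℝ} (hp0 : 0 < p) (hp1 : p < 1)
    {Ω : ℕ → Type*} [∀ n, MeasurableSpace (Ω n)]
    (P : ∀ n, Measure (Ω n)) [∀ n, IsProbabilityMeasure (P n)]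
    (X : ∀ n, Fin n → Ω n → ℝ)
    (hmeas : ∀ n i, AEMeasurable (X n i) (P n))
    (hunif : ∀ n i, pdf.IsUniform (X n i) (Set.Icc (0 : ℝ) 1) (P n) volume)
    (hindep : ∀ n, iIndepFun (X n) (P n)) :
    (∀ n, Integrable (fun ω => averageCost p (fun i => X n i ω)) (P n)) ∧
    (fun n : ℕ => (∫ ω, averageCost p (fun i => X n i ω) ∂(P n))
        - 1 / (2 * (1 - p)) * (Real.log n / n)) =O[atTop] (fun n : ℕ => 1 / (n : ℝ)) ∧
    (fun n : ℕ => averageCost p (equispaced n)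
        - 1 / (2 * Real.log p⁻¹) * (Real.log n / n)) =O[atTop] (fun n : ℕ => 1 / (n : ℝ)) ∧
    1 / (2 * Real.log p⁻¹) < 1 / (2 * (1 - p)) := by
  have ha0 : 0 < 1 - p := by linarith
  have hb : 0 < Real.log p⁻¹ := Real.log_pos ((one_lt_inv₀ hp0).2 hp1)
  have hmap := fun n => map_eq_pi_unitUniform (hmeas n) (hunif n) (hindep n)
  have haem : ∀ n, AEMeasurable (fun ω i => X n i ω) (P n) := fun n =>
    aemeasurable_pi_lambda _ fun i => hmeas n i
  refine ⟨fun n => ?_, ?_, ?_, ?_⟩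
  · refine Integrable.comp_aemeasurable (f := fun ω i => X n i ω)
      (g := fun x => averageCost p x) ?_ (haem n)
    rw [hmap]
    exact integrable_averageCost hp0 hp1 (ae_pi_unitUniform_mem_Icc n)
  · have hint : ∀ n, ∫ ω, averageCost p (fun i => X n i ω) ∂(P n) =
        ∫ x, averageCost p x ∂(Measure.pi fun _ : Fin n => unitUniform) := fun n => by
      rw [← hmap n, integral_map (haem n) measurable_averageCost.aestronglyMeasurable]
    simp only [hint]
    exact isBigO_of_eventually_bounds <|
      ((eventually_log_sq_le ha0).and (eventually_ge_atTop 2)).mono fun n h =>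
        uniform_mean_bounds hp0 hp1 h.2 h.1
  · refine isBigO_of_eventually_bounds <|
      ((eventually_log_sq_le hb).and (eventually_ge_atTop 1)).mono fun n h =>
        equispaced_mean_bounds hp0 hp1 h.2 ?_
    have := h.1
    have := Real.log_natCast_nonneg n
    nlinarith
  · have h := Real.log_lt_sub_one_of_pos hp0 hp1.ne
    refine one_div_lt_one_div_of_lt (by positivity) ?_
    rw [Real.log_inv]
    linarith
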